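/- Let $n \ge 1$ and let $\omega\in\mathbb{C}$ be a primitive $8$th root of unity. Put $$X=\begin{bmatrix}0&1\\1&0\end{bmatrix},\qquad Z=\begin{bmatrix}1&0\\0&-1\end{bmatrix},\qquad S=\begin{bmatrix}1&0\\0&\omega^2\end{bmatrix},$$ and for a $2\times 2$ unitary matrix $U$ let $U_i=I_2^{\otimes(i-1)}\otimes U\otimes I_2^{\otimes(n-i)}$ ($1\le i\le n$). Let $\mathrm{Pauli}_n=\langle X_1,\dots,X_n,Z_1,\dots,Z_n,\omega^2 I_2^{\otimes n}\rangle\le U(2^n)$ be the $n$-qubit Pauli group, let $\mathrm{Cliff}_n$ be the normalizer of $\mathrm{Pauli}_n$ in the unitary group $U(2^n)$, and let $$\mathcal{C}_n=\mathrm{Cliff}_n/\{c\,I_2^{\otimes n} : c\in\mathbb{C},\ |c|=1\}$$ be the $n$-qubit projective Clifford group (Clifford operators modulo global phase). The phase gate $S_1$ lies in $\mathrm{Cliff}_n$; let $s_1$ be its class in $\mathcal{C}_n$. Let $V$ be the conjugacy class of $s_1$ in $\mathcal{C}_n$, and for $g\in\mathcal{C}_n$ let $\sigma_g$ be the permutation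 $v\mapsto gvg^{-1}$ of $V$. Then $g\mapsto\sigma_g$ is a faithful (that is, injective) group homomorphism $\mathcal{C}_n\to\mathrm{Sym}_V$. Moreover, $|V|=2(4^n-1)$; consequently there is an injective group homomorphism $\mathcal{C}_n\to\mathrm{Sym}_{2(4^n-1)}$. -/

import Mathlib

open scoped Matrix

namespace QubitClifford

/-- The group `U(2^n)` of unitary operators on `n` qubits. The computational basis of
`(ℂ²)^{⊗ n}` is labelled by bit strings `Fin n → Fin 2`. -/
abbrev UnitaryGroup (n : ℕ) : Type := Matrix.unitaryGroup (Fin n → Fin 2) ℂ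

/-- The group `U(2)` of gates on one qubit. -/
abbrev Gate : Type := Matrix.unitaryGroup (Fin 2) ℂ

/-- The tensor product `A 0 ⊗ A 1 ⊗ ⋯ ⊗ A (n-1)` of `2 × 2` matrices. -/
def tensor {n : ℕ} (A : Fin n → Matrix (Fin 2) (Fin 2) ℂ) :
    Matrix (Fin n → Fin 2) (Fin n → Fin 2) ℂ :=
  Matrix.of fun x y => ∏ j, A j (x j) (y j)

theorem tensor_mul {n : ℕ} (A B : Fin n → Matrix (Fin 2) (Fin 2) ℂ) :
    tensor A * tensor B = tensor (fun j => A j * B j) := by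
  ext x y
  simp only [tensor, Matrix.mul_apply, Matrix.of_apply, Finset.prod_univ_sum,
    Fintype.piFinset_univ, Finset.prod_mul_distrib]

theorem tensor_one {n : ℕ} :
    tensor (fun _ : Fin n => (1 : Matrix (Fin 2) (Fin 2) ℂ)) = 1 := by
  ext x y
  by_cases h : x = y
  · subst h; simp [tensor]
  · obtain ⟨j, hj⟩ := Function.ne_iff.mp h
    rw [Matrix.one_apply_ne h]
    exact Finset.prod_eq_zero (Finset.mem_univ j) (Matrix.one_apply_ne hj)

theorem star_tensor {n : ℕ} (A : Fin n → Matrix (Fin 2) (Fin 2) ℂ) :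
    star (tensor A) = tensor (fun j => star (A j)) := by
  ext x y
  simp [tensor, Matrix.star_apply]

/-- The tensor product of `n` one-qubit gates, as a group homomorphism `U(2)^n → U(2^n)`. -/
def tensorGate (n : ℕ) : (Fin n → Gate) →* UnitaryGroup n where
  toFun A := ⟨tensor fun j => (A j : Matrix (Fin 2) (Fin 2) ℂ), by
    rw [Matrix.mem_unitaryGroup_iff, star_tensor, tensor_mul, ← tensor_one]
    congr 1
    funext j
    exact Matrix.mem_unitaryGroup_iff.mp (A j).2⟩
  map_one' := Subtype.ext tensor_one
  map_mul' A B := Subtype.ext (tensor_mul _ _).symm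

/-- `U_i = I ⊗ ⋯ ⊗ I ⊗ U ⊗ I ⊗ ⋯ ⊗ I`: the gate `U` applied to the qubit `i`. -/
def onQubit {n : ℕ} (i : Fin n) : Gate →* UnitaryGroup n :=
  (tensorGate n).comp (MonoidHom.mulSingle (fun _ : Fin n => Gate) i)

/-- The scalar operator `c I` for a complex number `c` of modulus one. -/
def scalarGate (n : ℕ) : unitary ℂ →* UnitaryGroup n where
  toFun c := ⟨(c : ℂ) • 1, by
    rw [Matrix.mem_unitaryGroup_iff, star_smul, star_one, smul_mul_smul_comm, mul_one,
      Unitary.mul_star_self_of_mem c.2, one_smul]⟩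
  map_one' := Subtype.ext (one_smul _ _)
  map_mul' c d := Subtype.ext (by
    change ((c * d : unitary ℂ) : ℂ) • (1 : Matrix (Fin n → Fin 2) (Fin n → Fin 2) ℂ)
      = ((c : ℂ) • 1) * ((d : ℂ) • 1)
    rw [smul_mul_smul_comm, mul_one]; rfl)

/-- The gate `X`. -/
def gateX : Gate :=
  ⟨!![0, 1; 1, 0], by
    rw [Matrix.mem_unitaryGroup_iff]
    ext i j; fin_cases i <;> fin_cases j <;> simp [Matrix.mul_apply, Matrix.star_apply]⟩

/-- The gate `Z`. -/
def gateZ : Gate :=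
  ⟨!![1, 0; 0, -1], by
    rw [Matrix.mem_unitaryGroup_iff]
    ext i j; fin_cases i <;> fin_cases j <;> simp [Matrix.mul_apply, Matrix.star_apply]⟩

/-- A primitive eighth root of unity `ω`, as a complex number of modulus one. -/
def root {ω : ℂ} (hω : IsPrimitiveRoot ω 8) : unitary ℂ :=
  ⟨ω, by
    rw [Unitary.mem_iff_self_mul_star, Complex.star_def, Complex.mul_conj,
      Complex.normSq_eq_norm_sq, Complex.norm_eq_one_of_pow_eq_one hω.pow_eq_one (by norm_num)]
    norm_num⟩

/-- The phase gate `S = diag(1, ω²)`. -/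
def gateS {ω : ℂ} (hω : IsPrimitiveRoot ω 8) : Gate :=
  ⟨!![1, 0; 0, ω ^ 2], by
    have h : ω * star ω = 1 := Unitary.mul_star_self_of_mem (root hω).2
    have h2 : ω ^ 2 * star ω ^ 2 = 1 := by rw [← mul_pow, h, one_pow]
    rw [Complex.star_def] at h2
    rw [Matrix.mem_unitaryGroup_iff]
    ext i j; fin_cases i <;> fin_cases j <;> simp [Matrix.mul_apply, Matrix.star_apply, h2]⟩

/-- The `n`-qubit Pauli group `⟨X_1, …, X_n, Z_1, …, Z_n, ω² I⟩`. -/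
def pauliGroup {ω : ℂ} (hω : IsPrimitiveRoot ω 8) (n : ℕ) : Subgroup (UnitaryGroup n) :=
  Subgroup.closure
    (Set.range (fun i : Fin n => onQubit i gateX) ∪ Set.range (fun i : Fin n => onQubit i gateZ) ∪
      {scalarGate n (root hω ^ 2)})

/-- The `n`-qubit Clifford group: the normalizer of the Pauli group in `U(2^n)`. -/
def cliffordGroup {ω : ℂ} (hω : IsPrimitiveRoot ω 8) (n : ℕ) : Subgroup (UnitaryGroup n) :=
  Subgroup.normalizer (pauliGroup hω n : Set (UnitaryGroup n))

/-- The global phases: the Clifford operators that are scalar. -/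
def globalPhases {ω : ℂ} (hω : IsPrimitiveRoot ω 8) (n : ℕ) : Subgroup (cliffordGroup hω n) :=
  (scalarGate n).range.subgroupOf (cliffordGroup hω n)

theorem scalarGate_comm {n : ℕ} (c : unitary ℂ) (U : UnitaryGroup n) :
    U * scalarGate n c = scalarGate n c * U := by
  apply Subtype.ext
  change (U : Matrix (Fin n → Fin 2) (Fin n → Fin 2) ℂ) * ((c : ℂ) • 1) = ((c : ℂ) • 1) * U
  simp

instance globalPhases_normal {ω : ℂ} (hω : IsPrimitiveRoot ω 8) (n : ℕ) :
    (globalPhases hω n).Normal where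
  conj_mem := by
    rintro U ⟨c, hc⟩ V
    refine ⟨c, ?_⟩
    have h : (V : UnitaryGroup n) * U = U * V := by
      rw [show (U : UnitaryGroup n) = scalarGate n c from hc.symm]
      exact scalarGate_comm c (V : UnitaryGroup n)
    rw [hc]
    change (U : UnitaryGroup n) = V * U * (V : UnitaryGroup n)⁻¹
    rw [h, mul_inv_cancel_right]

/-- The `n`-qubit projective Clifford group `C_n`: Clifford operators modulo global phase. -/
abbrev ProjectiveCliffordGroup {ω : ℂ} (hω : IsPrimitiveRoot ω 8) (n : ℕ) : Type :=
  cliffordGroup hω n ⧸ globalPhases hω n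

theorem gateS_pow_four {ω : ℂ} (hω : IsPrimitiveRoot ω 8) : gateS hω ^ 4 = 1 := by
  have h8 : (ω ^ 2) ^ 4 = 1 := by rw [← pow_mul]; exact hω.pow_eq_one
  apply Subtype.ext
  change (!![1, 0; 0, ω ^ 2] : Matrix (Fin 2) (Fin 2) ℂ) ^ 4 = 1
  have : (!![1, 0; 0, ω ^ 2] : Matrix (Fin 2) (Fin 2) ℂ) = Matrix.diagonal ![1, ω ^ 2] := by
    ext i j; fin_cases i <;> fin_cases j <;> simp
  rw [this, Matrix.diagonal_pow, ← Matrix.diagonal_one]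
  congr 1
  funext i; fin_cases i <;> simp [h8]

theorem omega_pow_four {ω : ℂ} (hω : IsPrimitiveRoot ω 8) : ω ^ 4 = -1 := by
  have h1 : ω ^ 4 ≠ 1 := hω.pow_ne_one_of_pos_of_lt (by norm_num) (by norm_num)
  have h2 : (ω ^ 4) ^ 2 = 1 := by rw [← pow_mul]; exact hω.pow_eq_one
  exact (mul_self_eq_one_iff.mp ((sq _).symm.trans h2)).resolve_left h1

theorem onQubit_commute {n : ℕ} {i j : Fin n} (h : i ≠ j) (A B : Gate) :
    Commute (onQubit i A) (onQubit j B) :=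
  have h1 : Commute (Pi.mulSingle i A : Fin n → Gate) (Pi.mulSingle j B) :=
    Pi.mulSingle_commute (f := fun _ : Fin n => Gate) h A B
  h1.map (tensorGate n)

theorem onQubit_mul_scalar {n : ℕ} (i : Fin n) (A : Gate) (c : unitary ℂ) (B : Gate)
    (h : (B : Matrix (Fin 2) (Fin 2) ℂ) = (c : ℂ) • (A : Matrix (Fin 2) (Fin 2) ℂ)) :
    onQubit i B = scalarGate n c * onQubit i A := by
  apply Subtype.ext
  change tensor _ = ((c : ℂ) • 1) * tensor _
  rw [smul_mul_assoc, one_mul]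
  ext x y
  simp only [tensor, Matrix.of_apply, Matrix.smul_apply, smul_eq_mul]
  rw [← Finset.mul_prod_erase _ _ (Finset.mem_univ i), ← Finset.mul_prod_erase _ _
    (Finset.mem_univ i), ← mul_assoc]
  congr 1
  · simp [h]
  · refine Finset.prod_congr rfl fun j hj => ?_
    have hj' := Finset.ne_of_mem_erase hj
    simp [Pi.mulSingle_eq_of_ne hj']

theorem gateS_conj {ω : ℂ} (hω : IsPrimitiveRoot ω 8) {n : ℕ} (i : Fin n)
    {P : UnitaryGroup n} (hP : P ∈ pauliGroup hω n) :
    onQubit i (gateS hω) * P * (onQubit i (gateS hω))⁻¹ ∈ pauliGroup hω n := by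
  have hX : ∀ j, onQubit j gateX ∈ pauliGroup hω n := fun j =>
    Subgroup.subset_closure (Or.inl (Or.inl ⟨j, rfl⟩))
  have hZ : ∀ j, onQubit j gateZ ∈ pauliGroup hω n := fun j =>
    Subgroup.subset_closure (Or.inl (Or.inr ⟨j, rfl⟩))
  have hs : scalarGate n (root hω ^ 2) ∈ pauliGroup hω n := Subgroup.subset_closure (Or.inr rfl)
  have h4 := omega_pow_four hω
  have key : pauliGroup hω n ≤ (pauliGroup hω n).comap
      (MulAut.conj (onQubit i (gateS hω))).toMonoidHom := by
    refine (Subgroup.closure_le _).mpr ?_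
    rintro _ ((⟨j, rfl⟩ | ⟨j, rfl⟩) | rfl) <;>
      simp only [Subgroup.coe_comap, Set.mem_preimage, MulEquiv.coe_toMonoidHom,
        MulAut.conj_apply, SetLike.mem_coe]
    · by_cases hij : i = j
      · subst hij
        have h1 : onQubit i (gateS hω * gateX)
            = scalarGate n (root hω ^ 2) * onQubit i (gateX * gateZ * gateS hω) := by
          refine onQubit_mul_scalar i _ _ _ ?_
          change !![1, 0; 0, ω ^ 2] * !![0, 1; 1, 0]
            = ω ^ 2 • (!![0, 1; 1, 0] * !![1, 0; 0, -1] * !![1, 0; 0, ω ^ 2])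
          have h4' : ω ^ 2 * ω ^ 2 = -1 := by rw [← pow_add]; exact h4
          ext a b; fin_cases a <;> fin_cases b <;> simp [h4']
        rw [← map_mul, h1, map_mul, ← mul_assoc, mul_inv_cancel_right, map_mul]
        exact mul_mem hs (mul_mem (hX i) (hZ i))
      · rw [(onQubit_commute hij _ _).eq, mul_inv_cancel_right]
        exact hX j
    · by_cases hij : i = j
      · subst hij
        have h1 : gateS hω * gateZ = gateZ * gateS hω := by
          apply Subtype.ext
          change !![1, 0; 0, ω ^ 2] * !![1, 0; 0, -1]
            = !![1, 0; 0, -1] * !![1, 0; 0, ω ^ 2]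
          ext a b; fin_cases a <;> fin_cases b <;> simp
        rw [← map_mul, h1, map_mul, mul_inv_cancel_right]
        exact hZ i
      · rw [(onQubit_commute hij _ _).eq, mul_inv_cancel_right]
        exact hZ j
    · rw [scalarGate_comm, mul_inv_cancel_right]
      exact hs
  exact key hP

theorem phase_mem_cliffordGroup {ω : ℂ} (hω : IsPrimitiveRoot ω 8) {n : ℕ} (i : Fin n) :
    onQubit i (gateS hω) ∈ cliffordGroup hω n := by
  rw [cliffordGroup, Subgroup.mem_normalizer_iff]
  intro P
  refine ⟨fun hP => gateS_conj hω i hP, fun hP => ?_⟩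
  have h := gateS_conj hω i (gateS_conj hω i (gateS_conj hω i hP))
  have h4 : onQubit i (gateS hω) ^ 4 = (1 : UnitaryGroup n) := by
    rw [← map_pow, gateS_pow_four, map_one]
  have e : ∀ S : UnitaryGroup n, S ^ 4 = 1 →
      S * (S * (S * (S * P * S⁻¹) * S⁻¹) * S⁻¹) * S⁻¹ = P := by
    intro S hS
    have : S * (S * (S * (S * P * S⁻¹) * S⁻¹) * S⁻¹) * S⁻¹ = S ^ 4 * P * (S ^ 4)⁻¹ := by
      simp only [pow_succ, pow_zero, one_mul, mul_inv_rev, mul_assoc]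
    rw [this, hS, one_mul, inv_one, mul_one]
  exact e _ h4 ▸ h

/-- The class `s_i` in `C_n` of the phase gate `S_i` on the qubit `i`. -/
def phase {ω : ℂ} (hω : IsPrimitiveRoot ω 8) {n : ℕ} (i : Fin n) :
    ProjectiveCliffordGroup hω n :=
  QuotientGroup.mk (⟨onQubit i (gateS hω), phase_mem_cliffordGroup hω i⟩ : cliffordGroup hω n)

/-- The conjugacy class `V` of `s_i` in `C_n`. -/
def phaseClass {ω : ℂ} (hω : IsPrimitiveRoot ω 8) {n : ℕ} (i : Fin n) :
    Set (ProjectiveCliffordGroup hω n) :=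
  conjugatesOf (phase hω i)

end QubitClifford

/-! Write i = ω², so that i² = -1. To a Hermitian Pauli operator P (one with P² = 1) attach the
phase operator S_P = ((1 + i) I + (1 - i) P) / 2; the gate S_j is S_P for P = Z_j. Since S_P is a
polynomial in P, U S_P U⁻¹ = S_{UPU⁻¹} for every Clifford U. The theorem follows from identifying V,
as a set with an action of the projective Clifford group, with the set of Hermitian Paulis other
than ±I.

Two facts give this identification. Clifford operators act transitively on these Paulis
(`exists_conj_eq`), so V consists of all classes of the S_P; and S_P determines P even up to a phase
(`phaseOperator_injective`). Both use a Pauli R that anticommutes with two given Paulis at once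
(`exists_anticommute_both`). Counting Hermitian Paulis by a sign and n tensor factors gives 2·4ⁿ,
and removing ±I leaves |V| = 2(4ⁿ - 1).

Faithfulness is Schur's lemma: a Clifford operator whose class fixes V pointwise commutes with every
X_j and Z_j, hence is scalar (`eq_scalarGate_of_commute`). -/

namespace QubitClifford

variable {ω : ℂ} {n : ℕ}

/-! ### Matrix entries and the commutant of the Pauli operators -/

theorem onQubit_apply (j : Fin n) (A : Gate) (x y : Fin n → Fin 2) :
    (onQubit j A : Matrix (Fin n → Fin 2) (Fin n → Fin 2) ℂ) x y =
      if ∀ k, k ≠ j → x k = y k then (A : Matrix (Fin 2) (Fin 2) ℂ) (x j) (y j) else 0 := by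
  change ∏ k, ((Pi.mulSingle j A : Fin n → Gate) k : Matrix (Fin 2) (Fin 2) ℂ) (x k) (y k) = _
  split_ifs with h
  · rw [Finset.prod_eq_single j]
    · simp
    · intro k _ hk
      simp [Pi.mulSingle_eq_of_ne hk, h k hk]
    · simp
  · push Not at h
    obtain ⟨k, hk, hxy⟩ := h
    refine Finset.prod_eq_zero (Finset.mem_univ k) ?_
    simp [Pi.mulSingle_eq_of_ne hk, hxy]

theorem onQubit_mul_apply (j : Fin n) (A : Gate)
    (M : Matrix (Fin n → Fin 2) (Fin n → Fin 2) ℂ) (x y : Fin n → Fin 2) :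
    ((onQubit j A : Matrix (Fin n → Fin 2) (Fin n → Fin 2) ℂ) * M) x y =
      ∑ b, (A : Matrix (Fin 2) (Fin 2) ℂ) (x j) b * M (Function.update x j b) y := by
  rw [Matrix.mul_apply]
  symm
  refine Fintype.sum_of_injective (fun b => Function.update x j b)
    (Function.update_injective x j) _ _ ?_ ?_
  · intro z hz
    rw [onQubit_apply, if_neg, zero_mul]
    intro h
    refine hz ⟨z j, ?_⟩
    ext k
    by_cases hk : k = j
    · subst hk; simp
    · simp [hk, h k hk]
  · intro b
    rw [onQubit_apply, if_pos]
    · simp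
    · intro k hk; simp [hk]

theorem mul_onQubit_apply (j : Fin n) (A : Gate)
    (M : Matrix (Fin n → Fin 2) (Fin n → Fin 2) ℂ) (x y : Fin n → Fin 2) :
    (M * (onQubit j A : Matrix (Fin n → Fin 2) (Fin n → Fin 2) ℂ)) x y =
      ∑ b, M x (Function.update y j b) * (A : Matrix (Fin 2) (Fin 2) ℂ) b (y j) := by
  rw [Matrix.mul_apply]
  symm
  refine Fintype.sum_of_injective (fun b => Function.update y j b)
    (Function.update_injective y j) _ _ ?_ ?_
  · intro z hz
    rw [onQubit_apply, if_neg, mul_zero]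
    intro h
    refine hz ⟨z j, ?_⟩
    ext k
    by_cases hk : k = j
    · subst hk; simp
    · simp [hk, h k hk]
  · intro b
    rw [onQubit_apply, if_pos]
    · simp
    · intro k hk; simp [hk]

theorem eq_of_forall_update_eq {α β : Type*} [Fintype α] [DecidableEq α] {γ : Type*}
    {f : (α → β) → γ} (h : ∀ x j b, f (Function.update x j b) = f x) (x y : α → β) :
    f x = f y := by
  have key : ∀ s : Finset α, f (s.piecewise x y) = f y := by
    intro s
    induction s using Finset.induction_on with
    | empty => simp
    | insert j s _ ih => rw [Finset.piecewise_insert, h, ih]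
  simpa using key Finset.univ

/-- Commuting with Z_j kills the entries whose row and column labels differ at bit j, so M is
diagonal. Commuting with X_j makes the diagonal invariant under flipping bit j, so it is constant.
-/
theorem matrix_eq_scalar_of_commute {M : Matrix (Fin n → Fin 2) (Fin n → Fin 2) ℂ}
    (hX : ∀ j : Fin n, (onQubit j gateX).1 * M = M * (onQubit j gateX).1)
    (hZ : ∀ j : Fin n, (onQubit j gateZ).1 * M = M * (onQubit j gateZ).1) :
    ∃ c : ℂ, M = c • 1 := by
  have hflip : ∀ x j b, M (Function.update x j b) (Function.update x j b) = M x x := by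
    intro x j b
    have h : ∀ z : Fin n → Fin 2, z j = 0 →
        M (Function.update z j 1) (Function.update z j 1) = M z z := by
      intro z hz
      -- At this entry, X_j M picks out the diagonal entry at the flipped label and M X_j the one at
      -- z.
      have := congrFun (congrFun (hX j) z) (Function.update z j 1)
      rw [onQubit_mul_apply, mul_onQubit_apply] at this
      have hz' : Function.update z j 0 = z := by rw [← hz]; simp
      simpa [gateX, hz, hz'] using this
    have h0 := h (Function.update x j 0) (by simp)
    simp only [Function.update_idem] at h0
    have hx : ∀ b, M (Function.update x j b) (Function.update x j b) =
        M (Function.update x j 0) (Function.update x j 0) := by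
      intro b; fin_cases b
      · rfl
      · exact h0
    rw [hx b, ← hx (x j), Function.update_eq_self]
  refine ⟨M 0 0, ?_⟩
  ext x y
  by_cases hxy : x = y
  · subst hxy
    simpa using eq_of_forall_update_eq (f := fun z => M z z) hflip x 0
  · obtain ⟨j, hj⟩ := Function.ne_iff.mp hxy
    have := congrFun (congrFun (hZ j) x) y
    rw [onQubit_mul_apply, mul_onQubit_apply] at this
    have hx := Function.update_eq_self j x
    have hy := Function.update_eq_self j y
    rw [Matrix.smul_apply, Matrix.one_apply_ne hxy, smul_zero]
    have two : ∀ a : Fin 2, a = 0 ∨ a = 1 := by decide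
    rcases two (x j) with ha | ha <;> rcases two (y j) with hb | hb <;>
      simp only [ha, hb, ne_eq, not_true_eq_false] at hj <;>
      simp only [ha, hb] at hx hy this <;>
      simp [gateZ, hx, hy] at this
    · linear_combination this / 2
    · linear_combination -this / 2

theorem coe_scalarGate (c : unitary ℂ) :
    (scalarGate n c : Matrix (Fin n → Fin 2) (Fin n → Fin 2) ℂ) = (c : ℂ) • 1 := rfl

theorem scalarGate_neg_one : scalarGate n (-1) = -1 :=
  Subtype.ext (by rw [coe_scalarGate]; simp [Unitary.coe_neg])

theorem eq_scalarGate_of_commute {U : UnitaryGroup n}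
    (hX : ∀ j, U * onQubit j gateX = onQubit j gateX * U)
    (hZ : ∀ j, U * onQubit j gateZ = onQubit j gateZ * U) :
    ∃ c : unitary ℂ, U = scalarGate n c := by
  obtain ⟨c, hc⟩ := matrix_eq_scalar_of_commute
    (M := (U : Matrix (Fin n → Fin 2) (Fin n → Fin 2) ℂ))
    (fun j => congrArg Subtype.val (hX j).symm) (fun j => congrArg Subtype.val (hZ j).symm)
  have h := Matrix.mem_unitaryGroup_iff.mp U.2
  rw [hc, star_smul, star_one, smul_mul_smul_comm, mul_one] at h
  have h' := congrFun (congrFun h 0) 0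
  refine ⟨⟨c, Unitary.mem_iff_self_mul_star.mpr ?_⟩, Subtype.ext hc⟩
  simpa using h'

theorem ne_neg_self (U : UnitaryGroup n) : U ≠ -U := by
  intro h
  have h1 : (1 : UnitaryGroup n) = -1 := by
    have := congrArg (· * U⁻¹) h
    simpa using this
  have := congrFun (congrFun (congrArg Subtype.val h1) 0) 0
  norm_num [Unitary.coe_neg] at this

theorem eq_one_or_eq_neg_one_of_scalar {c : unitary ℂ}
    (h : scalarGate n c * scalarGate n c = 1) : scalarGate n c = 1 ∨ scalarGate n c = -1 := by
  have h' := congrFun (congrFun (congrArg Subtype.val h) 0) 0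
  rw [← map_mul] at h'
  have h2 : (c : ℂ) * c = 1 := by simpa [coe_scalarGate] using h'
  rcases mul_self_eq_one_iff.mp h2 with h3 | h3
  · left; exact Subtype.ext (by rw [coe_scalarGate, h3]; simp)
  · right; exact Subtype.ext (by rw [coe_scalarGate, h3]; simp [Unitary.coe_neg])

/-! ### Commutation and squares in the Pauli group -/

/-- The central Pauli operator `ω² I`. -/
def imaginaryUnit (hω : IsPrimitiveRoot ω 8) (n : ℕ) : UnitaryGroup n :=
  scalarGate n (root hω ^ 2)

theorem coe_imaginaryUnit (hω : IsPrimitiveRoot ω 8) :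
    (imaginaryUnit hω n : Matrix (Fin n → Fin 2) (Fin n → Fin 2) ℂ) = (ω ^ 2) • 1 := rfl

theorem omega_sq_mul_omega_sq (hω : IsPrimitiveRoot ω 8) : ω ^ 2 * ω ^ 2 = -1 := by
  rw [← pow_add]; exact omega_pow_four hω

theorem star_omega_sq (hω : IsPrimitiveRoot ω 8) : star (ω ^ 2) = -ω ^ 2 := by
  have h : ω * star ω = 1 := Unitary.mul_star_self_of_mem (root hω).2
  have h2 : ω ^ 2 * star (ω ^ 2) = 1 := by rw [star_pow, ← mul_pow, h, one_pow]
  linear_combination (-(ω ^ 2)) * h2 + star (ω ^ 2) * omega_sq_mul_omega_sq hω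

theorem imaginaryUnit_mul_self (hω : IsPrimitiveRoot ω 8) :
    imaginaryUnit hω n * imaginaryUnit hω n = -1 :=
  Subtype.ext (by
    change (imaginaryUnit hω n : Matrix (Fin n → Fin 2) (Fin n → Fin 2) ℂ) *
      imaginaryUnit hω n = _
    rw [coe_imaginaryUnit, smul_mul_smul_comm, omega_sq_mul_omega_sq hω]; simp [Unitary.coe_neg])

theorem mul_imaginaryUnit (hω : IsPrimitiveRoot ω 8) (U : UnitaryGroup n) :
    U * imaginaryUnit hω n = imaginaryUnit hω n * U :=
  scalarGate_comm _ U

theorem mul_imaginaryUnit_mul (hω : IsPrimitiveRoot ω 8) (U V : UnitaryGroup n) :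
    U * (imaginaryUnit hω n * V) = imaginaryUnit hω n * (U * V) := by
  rw [← mul_assoc, mul_imaginaryUnit, mul_assoc]

theorem imaginaryUnit_mul_mul (hω : IsPrimitiveRoot ω 8) (U : UnitaryGroup n) :
    imaginaryUnit hω n * (imaginaryUnit hω n * U) = -U := by
  rw [← mul_assoc, imaginaryUnit_mul_self, neg_one_mul]

theorem onQubit_X_mem (hω : IsPrimitiveRoot ω 8) (j : Fin n) :
    onQubit j gateX ∈ pauliGroup hω n := Subgroup.subset_closure (Or.inl (Or.inl ⟨j, rfl⟩))

theorem onQubit_Z_mem (hω : IsPrimitiveRoot ω 8) (j : Fin n) :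
    onQubit j gateZ ∈ pauliGroup hω n := Subgroup.subset_closure (Or.inl (Or.inr ⟨j, rfl⟩))

theorem imaginaryUnit_mem (hω : IsPrimitiveRoot ω 8) : imaginaryUnit hω n ∈ pauliGroup hω n :=
  Subgroup.subset_closure (Or.inr rfl)

theorem neg_mem_pauliGroup (hω : IsPrimitiveRoot ω 8) {P : UnitaryGroup n}
    (hP : P ∈ pauliGroup hω n) : -P ∈ pauliGroup hω n := by
  rw [← imaginaryUnit_mul_mul hω]
  exact mul_mem (imaginaryUnit_mem hω) (mul_mem (imaginaryUnit_mem hω) hP)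

theorem gateX_mul_self : gateX * gateX = 1 :=
  Subtype.ext (by
    change !![0, 1; 1, 0] * !![0, 1; 1, 0] = (1 : Matrix (Fin 2) (Fin 2) ℂ)
    ext a b; fin_cases a <;> fin_cases b <;> simp)

theorem gateZ_mul_self : gateZ * gateZ = 1 :=
  Subtype.ext (by
    change !![1, 0; 0, -1] * !![1, 0; 0, -1] = (1 : Matrix (Fin 2) (Fin 2) ℂ)
    ext a b; fin_cases a <;> fin_cases b <;> simp)

theorem gateX_mul_gateZ : gateX * gateZ = -(gateZ * gateX) :=
  Subtype.ext (by
    change !![0, 1; 1, 0] * !![1, 0; 0, -1] =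
      -(!![1, 0; 0, -1] * !![0, 1; 1, 0] : Matrix (Fin 2) (Fin 2) ℂ)
    ext a b; fin_cases a <;> fin_cases b <;> simp)

theorem onQubit_neg (j : Fin n) (A : Gate) : onQubit j (-A) = -onQubit j A := by
  rw [onQubit_mul_scalar j A (-1) (-A) (by simp [Unitary.coe_neg]), scalarGate_neg_one, neg_one_mul]

/-- Any two Pauli operators commute or anticommute. -/
theorem commute_or_anticommute (hω : IsPrimitiveRoot ω 8) {P Q : UnitaryGroup n}
    (hP : P ∈ pauliGroup hω n) (hQ : Q ∈ pauliGroup hω n) :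
    P * Q = Q * P ∨ P * Q = -(Q * P) := by
  have key : ∀ i j : Fin n, onQubit i gateX * onQubit j gateZ = onQubit j gateZ * onQubit i gateX
      ∨ onQubit i gateX * onQubit j gateZ = -(onQubit j gateZ * onQubit i gateX) := by
    intro i j
    by_cases h : i = j
    · subst h
      right
      rw [← map_mul, gateX_mul_gateZ, onQubit_neg, map_mul]
    · exact Or.inl (onQubit_commute h _ _).eq
  have same : ∀ (A : Gate) (i j : Fin n),
      onQubit i A * onQubit j A = onQubit j A * onQubit i A := by
    intro A i j
    by_cases h : i = j
    · rw [h]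
    · exact (onQubit_commute h _ _).eq
  refine Subgroup.closure_induction₂ (p := fun P Q _ _ => P * Q = Q * P ∨ P * Q = -(Q * P))
    ?_ ?_ ?_ ?_ ?_ ?_ ?_ hP hQ
  · rintro x y ((⟨i, rfl⟩ | ⟨i, rfl⟩) | rfl) ((⟨j, rfl⟩ | ⟨j, rfl⟩) | rfl)
    · exact Or.inl (same _ i j)
    · exact key i j
    · exact Or.inl (scalarGate_comm _ _)
    · rcases key j i with h | h
      · exact Or.inl h.symm
      · exact Or.inr (by simp only [h, neg_neg])
    · exact Or.inl (same _ i j)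
    · exact Or.inl (scalarGate_comm _ _)
    · exact Or.inl (scalarGate_comm _ _).symm
    · exact Or.inl (scalarGate_comm _ _).symm
    · exact Or.inl rfl
  · intro x _; simp
  · intro x _; simp
  · rintro x y z _ _ _ (h1 | h1) (h2 | h2) <;>
      rw [mul_assoc, h2, ← mul_assoc] <;> simp [h1, mul_assoc, ← mul_assoc x]
  · rintro x y z _ _ _ (h1 | h1) (h2 | h2) <;>
      rw [← mul_assoc, h1] <;> simp [h2, mul_assoc]
  · rintro x y _ _ (h | h)
    · left; rw [inv_mul_eq_iff_eq_mul, ← mul_assoc, h, mul_inv_cancel_right]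
    · right; rw [inv_mul_eq_iff_eq_mul, mul_neg, ← mul_assoc, h]; simp
  · rintro x y _ _ (h | h)
    · left; rw [eq_inv_mul_iff_mul_eq, ← mul_assoc, ← h, mul_inv_cancel_right]
    · right
      have h' : y * x = -(x * y) := by rw [h, neg_neg]
      calc x * y⁻¹ = y⁻¹ * (y * x) * y⁻¹ := by rw [inv_mul_cancel_left]
        _ = -(y⁻¹ * x) := by rw [h', mul_neg, neg_mul, mul_assoc, mul_inv_cancel_right]

/-- Since x and y commute up to sign, (xy)² = ±x²y², and the generators square to ±1. -/
theorem mul_self_pauli (hω : IsPrimitiveRoot ω 8) {P : UnitaryGroup n}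
    (hP : P ∈ pauliGroup hω n) : P * P = 1 ∨ P * P = -1 := by
  induction hP using Subgroup.closure_induction with
  | mem x hx =>
    rcases hx with (⟨i, rfl⟩ | ⟨i, rfl⟩) | rfl
    · left; simp only [← map_mul, gateX_mul_self, map_one]
    · left; simp only [← map_mul, gateZ_mul_self, map_one]
    · exact Or.inr (imaginaryUnit_mul_self hω)
  | one => simp
  | mul x y hx hy ihx ihy =>
    have e : x * y * (x * y) = x * (y * x) * y := by simp only [mul_assoc]
    have e' : x * (x * y) * y = (x * x) * (y * y) := by simp only [mul_assoc]
    rw [e]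
    rcases commute_or_anticommute hω hx hy with h | h
    · rw [← h, e']
      rcases ihx with h1 | h1 <;> rcases ihy with h2 | h2 <;> simp [h1, h2]
    · rw [← neg_eq_iff_eq_neg.mpr h, mul_neg, neg_mul, e']
      rcases ihx with h1 | h1 <;> rcases ihy with h2 | h2 <;> simp [h1, h2]
  | inv x hx ih =>
    rcases ih with h | h
    · left; rw [← mul_inv_rev, h, inv_one]
    · right; rw [← mul_inv_rev, h]; simp

/-- An operator commuting with the Pauli group is scalar. -/
theorem eq_scalarGate_of_commute_pauli (hω : IsPrimitiveRoot ω 8) {U : UnitaryGroup n}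
    (h : ∀ P ∈ pauliGroup hω n, U * P = P * U) : ∃ c : unitary ℂ, U = scalarGate n c :=
  eq_scalarGate_of_commute (fun j => h _ (onQubit_X_mem hω j)) fun j => h _ (onQubit_Z_mem hω j)

theorem star_coe_of_mul_self_eq_one {P : UnitaryGroup n} (hP : P * P = 1) : star P.1 = P.1 := by
  have h : P⁻¹ = P := inv_eq_of_mul_eq_one_right hP
  exact congrArg Subtype.val h

/-! ### Phase operators along Hermitian Paulis -/

/-- The phase gate `((1 + ω²) I + (1 - ω²) P) / 2` along an involution `P`; it is the unitary with
eigenvalue `1` on the `+1`-eigenspace of `P` and `ω²` on the `-1`-eigenspace. -/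
noncomputable def phaseOperator (hω : IsPrimitiveRoot ω 8) (P : UnitaryGroup n) (hP : P * P = 1) :
    UnitaryGroup n :=
  ⟨((1 + ω ^ 2) / 2) • 1 + ((1 - ω ^ 2) / 2) • P.1, by
    have hPP : P.1 * P.1 = 1 := congrArg Subtype.val hP
    have h2 : star (2 : ℂ) = 2 := by simp
    have hi := omega_sq_mul_omega_sq hω
    rw [Matrix.mem_unitaryGroup_iff, star_add, star_smul, star_smul, star_one,
      star_coe_of_mul_self_eq_one hP, star_div₀, star_div₀, star_add, star_sub, star_one,
      star_omega_sq hω, h2]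
    simp only [add_mul, mul_add, smul_mul_smul_comm, mul_one, one_mul, hPP]
    -- The two I-terms contribute 1/2 each, while the P-terms ω²/2 and -ω²/2 cancel.
    rw [show ((1 + ω ^ 2) / 2 * ((1 + -ω ^ 2) / 2)) = 1 / 2 by linear_combination (-1 / 4) * hi,
      show ((1 - ω ^ 2) / 2 * ((1 - -ω ^ 2) / 2)) = 1 / 2 by linear_combination (-1 / 4) * hi,
      show ((1 - ω ^ 2) / 2 * ((1 + -ω ^ 2) / 2)) = - ω ^ 2 / 2 by linear_combination (1 / 4) * hi,
      show ((1 + ω ^ 2) / 2 * ((1 - -ω ^ 2) / 2)) = ω ^ 2 / 2 by linear_combination (1 / 4) * hi]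
    module⟩

theorem coe_phaseOperator (hω : IsPrimitiveRoot ω 8) {P : UnitaryGroup n} (hP : P * P = 1) :
    (phaseOperator hω P hP).1 = ((1 + ω ^ 2) / 2) • 1 + ((1 - ω ^ 2) / 2) • P.1 := rfl

theorem mul_phaseOperator (hω : IsPrimitiveRoot ω 8) {P Q U : UnitaryGroup n} (hP : P * P = 1)
    (hQ : Q * Q = 1) (h : U * P = Q * U) :
    U * phaseOperator hω P hP = phaseOperator hω Q hQ * U :=
  Subtype.ext (by
    have h' : U.1 * P.1 = Q.1 * U.1 := congrArg Subtype.val h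
    change U.1 * (phaseOperator hω P hP).1 = (phaseOperator hω Q hQ).1 * U.1
    simp only [coe_phaseOperator, add_mul, mul_add, mul_smul_comm, smul_mul_assoc, h', mul_one,
      one_mul])

/-- Moving R past S_P replaces P by -P, so S_P R S_P⁻¹ = S_P S_{-P}⁻¹ R. The operator S_P S_{-P}⁻¹
has eigenvalue -i where P = 1 and i where P = -1, so it equals -iP. -/
theorem phaseOperator_mul_of_anticommute (hω : IsPrimitiveRoot ω 8) {P R : UnitaryGroup n}
    (hP : P * P = 1) (h : P * R = -(R * P)) :
    phaseOperator hω P hP * R = -(imaginaryUnit hω n * (P * R)) * phaseOperator hω P hP :=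
  Subtype.ext (by
    have hi := omega_sq_mul_omega_sq hω
    have hPRP : P * R * P = -R := by rw [h, neg_mul, mul_assoc, hP, mul_one]
    have h' : P.1 * R.1 * P.1 = -R.1 := congrArg Subtype.val hPRP
    change (phaseOperator hω P hP).1 * R.1 =
      -((imaginaryUnit hω n).1 * (P.1 * R.1)) * (phaseOperator hω P hP).1
    simp only [coe_phaseOperator, coe_imaginaryUnit, add_mul, mul_add, mul_smul_comm,
      smul_mul_assoc, one_mul, mul_one, neg_mul, h', smul_neg, smul_smul]
    rw [show (1 + ω ^ 2) / 2 * ω ^ 2 = -((1 - ω ^ 2) / 2) by linear_combination (1 / 2) * hi,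
      show (1 - ω ^ 2) / 2 * ω ^ 2 = (1 + ω ^ 2) / 2 by linear_combination (-1 / 2) * hi]
    module)

theorem mul_mul_inv_eq {G : Type*} [Group G] {a b c : G} (h : a * b = c * a) :
    a * b * a⁻¹ = c := by
  rw [h, mul_inv_cancel_right]

theorem phaseOperator_conj_mem (hω : IsPrimitiveRoot ω 8) {P R : UnitaryGroup n}
    (hP : P * P = 1) (hPm : P ∈ pauliGroup hω n) (hR : R ∈ pauliGroup hω n) :
    phaseOperator hω P hP * R * (phaseOperator hω P hP)⁻¹ ∈ pauliGroup hω n := by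
  rcases commute_or_anticommute hω hPm hR with h | h
  · rwa [mul_mul_inv_eq (mul_phaseOperator hω hP hP h.symm).symm]
  · rw [mul_mul_inv_eq (phaseOperator_mul_of_anticommute hω hP h)]
    exact neg_mem_pauliGroup hω (mul_mem (imaginaryUnit_mem hω) (mul_mem hPm hR))

theorem phaseOperator_mul_self (hω : IsPrimitiveRoot ω 8) {P : UnitaryGroup n} (hP : P * P = 1) :
    phaseOperator hω P hP * phaseOperator hω P hP = P :=
  Subtype.ext (by
    have hi := omega_sq_mul_omega_sq hω
    have hPP : P.1 * P.1 = 1 := congrArg Subtype.val hP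
    change (phaseOperator hω P hP).1 * (phaseOperator hω P hP).1 = P.1
    simp only [coe_phaseOperator, add_mul, mul_add, smul_mul_smul_comm, mul_one, one_mul, hPP]
    rw [show (1 + ω ^ 2) / 2 * ((1 + ω ^ 2) / 2) = ω ^ 2 / 2 by linear_combination (1 / 4) * hi,
      show (1 - ω ^ 2) / 2 * ((1 - ω ^ 2) / 2) = -(ω ^ 2 / 2) by linear_combination (1 / 4) * hi,
      show (1 + ω ^ 2) / 2 * ((1 - ω ^ 2) / 2) = 1 / 2 by linear_combination (-1 / 4) * hi,
      show (1 - ω ^ 2) / 2 * ((1 + ω ^ 2) / 2) = 1 / 2 by linear_combination (-1 / 4) * hi]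
    module)

theorem phaseOperator_mem_cliffordGroup (hω : IsPrimitiveRoot ω 8) {P : UnitaryGroup n}
    (hP : P * P = 1) (hPm : P ∈ pauliGroup hω n) :
    phaseOperator hω P hP ∈ cliffordGroup hω n := by
  rw [cliffordGroup, Subgroup.mem_normalizer_iff]
  intro R
  refine ⟨phaseOperator_conj_mem hω hP hPm, fun h => ?_⟩
  -- Conjugating once more by S_P amounts to conjugating R by S_P² = P, which is itself a Pauli
  -- operator and can be undone inside the group.
  have h2 := phaseOperator_conj_mem hω hP hPm h
  have e : phaseOperator hω P hP * (phaseOperator hω P hP * R * (phaseOperator hω P hP)⁻¹) *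
      (phaseOperator hω P hP)⁻¹ = (phaseOperator hω P hP * phaseOperator hω P hP) * R *
        (phaseOperator hω P hP * phaseOperator hω P hP)⁻¹ := by
    rw [mul_inv_rev]; simp only [mul_assoc]
  rw [e, phaseOperator_mul_self] at h2
  have h3 := mul_mem (mul_mem (inv_mem hPm) h2) hPm
  simpa only [mul_assoc, inv_mul_cancel_left, inv_mul_cancel, mul_one] using h3

theorem conj_mem_pauliGroup (hω : IsPrimitiveRoot ω 8) {U P : UnitaryGroup n}
    (hU : U ∈ cliffordGroup hω n) (hP : P ∈ pauliGroup hω n) :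
    U * P * U⁻¹ ∈ pauliGroup hω n :=
  (Subgroup.mem_normalizer_iff.mp hU P).mp hP

/-! ### Transitivity of the Clifford group on non-scalar Hermitian Paulis -/

/-- The Hermitian Pauli operators. -/
def hermitianPauli (hω : IsPrimitiveRoot ω 8) (n : ℕ) : Set (UnitaryGroup n) :=
  {P | P ∈ pauliGroup hω n ∧ P * P = 1}

/-- The non-scalar Hermitian Pauli operators. -/
def properPauli (hω : IsPrimitiveRoot ω 8) (n : ℕ) : Set (UnitaryGroup n) :=
  hermitianPauli hω n \ {1, -1}

theorem onQubit_Z_mem_properPauli (hω : IsPrimitiveRoot ω 8) (j : Fin n) :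
    onQubit j gateZ ∈ properPauli hω n := by
  have h : onQubit j gateX * onQubit j gateZ = -(onQubit j gateZ * onQubit j gateX) := by
    rw [← map_mul, gateX_mul_gateZ, onQubit_neg, map_mul]
  refine ⟨⟨onQubit_Z_mem hω j, by rw [← map_mul, gateZ_mul_self, map_one]⟩, ?_⟩
  rintro (h1 | h1)
  · rw [h1, mul_one, one_mul] at h
    exact ne_neg_self _ h
  · rw [Set.mem_singleton_iff.mp h1, mul_neg_one, neg_one_mul] at h
    exact ne_neg_self _ h

theorem onQubit_X_mem_properPauli (hω : IsPrimitiveRoot ω 8) (j : Fin n) :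
    onQubit j gateX ∈ properPauli hω n := by
  have h : onQubit j gateX * onQubit j gateZ = -(onQubit j gateZ * onQubit j gateX) := by
    rw [← map_mul, gateX_mul_gateZ, onQubit_neg, map_mul]
  refine ⟨⟨onQubit_X_mem hω j, by rw [← map_mul, gateX_mul_self, map_one]⟩, ?_⟩
  rintro (h1 | h1)
  · rw [h1, mul_one, one_mul] at h
    exact ne_neg_self _ h
  · rw [Set.mem_singleton_iff.mp h1, mul_neg_one, neg_one_mul] at h
    exact ne_neg_self _ h

theorem conj_mem_properPauli (hω : IsPrimitiveRoot ω 8) {U P : UnitaryGroup n}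
    (hU : U ∈ cliffordGroup hω n) (hP : P ∈ properPauli hω n) :
    U * P * U⁻¹ ∈ properPauli hω n := by
  obtain ⟨⟨hPm, hPP⟩, hne⟩ := hP
  refine ⟨⟨conj_mem_pauliGroup hω hU hPm, ?_⟩, ?_⟩
  · rw [show U * P * U⁻¹ * (U * P * U⁻¹) = U * (P * P) * U⁻¹ by group, hPP]; simp
  · rintro (h | h)
    · exact hne (Or.inl (by rwa [mul_inv_eq_one, mul_eq_left] at h))
    · refine hne (Or.inr ?_)
      have h' : U * P * U⁻¹ = -1 := h
      rw [mul_inv_eq_iff_eq_mul, neg_one_mul, ← mul_neg_one] at h'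
      exact mul_left_cancel h'

/-- Otherwise P would commute with all Paulis, hence be scalar, and P² = 1 would leave only the
excluded values ±1. -/
theorem exists_anticommute (hω : IsPrimitiveRoot ω 8) {P : UnitaryGroup n}
    (hP : P ∈ properPauli hω n) : ∃ R ∈ pauliGroup hω n, P * R = -(R * P) := by
  by_contra hcon
  push Not at hcon
  obtain ⟨c, rfl⟩ := eq_scalarGate_of_commute_pauli hω (U := P) fun R hR =>
    (commute_or_anticommute hω hP.1.1 hR).resolve_right (hcon R hR)
  exact hP.2 (eq_one_or_eq_neg_one_of_scalar hP.1.2)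

theorem anticommute_mul {G : Type*} [Monoid G] [HasDistribNeg G] {a b c : G}
    (h1 : a * b = b * a) (h2 : a * c = -(c * a)) : a * (b * c) = -(b * c * a) := by
  rw [← mul_assoc, h1, mul_assoc, h2, mul_neg, mul_assoc]

theorem anticommute_mul' {G : Type*} [Monoid G] [HasDistribNeg G] {a b c : G}
    (h1 : a * b = -(b * a)) (h2 : a * c = c * a) : a * (b * c) = -(b * c * a) := by
  rw [← mul_assoc, h1, neg_mul, mul_assoc, h2, mul_assoc]

theorem exists_anticommute_both (hω : IsPrimitiveRoot ω 8) {P Q : UnitaryGroup n}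
    (hP : P ∈ properPauli hω n) (hQ : Q ∈ properPauli hω n) :
    ∃ R ∈ hermitianPauli hω n, P * R = -(R * P) ∧ Q * R = -(R * Q) := by
  have h : ∃ R ∈ pauliGroup hω n, P * R = -(R * P) ∧ Q * R = -(R * Q) := by
    obtain ⟨A, hA, hPA⟩ := exists_anticommute hω hP
    obtain ⟨B, hB, hQB⟩ := exists_anticommute hω hQ
    rcases commute_or_anticommute hω hQ.1.1 hA with hQA | hQA
    · rcases commute_or_anticommute hω hP.1.1 hB with hPB | hPB
      -- Here A anticommutes only with P and B only with Q, so the product anticommutes with both.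
      · exact ⟨A * B, mul_mem hA hB, anticommute_mul' hPA hPB, anticommute_mul hQA hQB⟩
      · exact ⟨B, hB, hPB, hQB⟩
    · exact ⟨A, hA, hPA, hQA⟩
  obtain ⟨R, hR, h1, h2⟩ := h
  rcases mul_self_pauli hω hR with h3 | h3
  · exact ⟨R, ⟨hR, h3⟩, h1, h2⟩
  -- If R² = -1, the central factor i turns R into an involution without changing its commutation
  -- signs.
  · exact ⟨imaginaryUnit hω n * R, ⟨mul_mem (imaginaryUnit_mem hω) hR, by
      rw [mul_assoc, mul_imaginaryUnit_mul, imaginaryUnit_mul_mul, h3, neg_neg]⟩,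
      anticommute_mul (mul_imaginaryUnit hω P) h1, anticommute_mul (mul_imaginaryUnit hω Q) h2⟩

/-- The phase operator along A = iQP works: A is a Hermitian Pauli anticommuting with P, so S_A
sends P to -iAP = Q. -/
theorem exists_conj_eq_of_anticommute (hω : IsPrimitiveRoot ω 8) {P Q : UnitaryGroup n}
    (hP : P ∈ hermitianPauli hω n) (hQ : Q ∈ hermitianPauli hω n) (h : P * Q = -(Q * P)) :
    ∃ U ∈ cliffordGroup hω n, U * P = Q * U := by
  have h' : P * (Q * P) = -Q := by rw [← mul_assoc, h, neg_mul, mul_assoc, hP.2, mul_one]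
  have hA : imaginaryUnit hω n * (Q * P) * (imaginaryUnit hω n * (Q * P)) = 1 := by
    rw [mul_assoc, mul_imaginaryUnit_mul, imaginaryUnit_mul_mul, mul_assoc, h', mul_neg, hQ.2,
      neg_neg]
  refine ⟨phaseOperator hω _ hA, phaseOperator_mem_cliffordGroup hω hA
    (mul_mem (imaginaryUnit_mem hω) (mul_mem hQ.1 hP.1)), ?_⟩
  rw [phaseOperator_mul_of_anticommute hω hA]
  · congr 1
    rw [mul_assoc (imaginaryUnit hω n), imaginaryUnit_mul_mul, mul_assoc, hP.2, mul_one, neg_neg]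
  · rw [mul_assoc, mul_assoc, hP.2, mul_imaginaryUnit_mul, h', mul_one, mul_neg, neg_neg]

/-- P and Q may commute, so the passage goes through a Hermitian R anticommuting with both. -/
theorem exists_conj_eq (hω : IsPrimitiveRoot ω 8) {P Q : UnitaryGroup n}
    (hP : P ∈ properPauli hω n) (hQ : Q ∈ properPauli hω n) :
    ∃ U ∈ cliffordGroup hω n, U * P = Q * U := by
  obtain ⟨R, hR, h1, h2⟩ := exists_anticommute_both hω hP hQ
  obtain ⟨U, hU, hUP⟩ := exists_conj_eq_of_anticommute hω hP.1 hR h1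
  obtain ⟨V, hV, hVR⟩ := exists_conj_eq_of_anticommute hω hR hQ.1 (by rw [h2, neg_neg])
  exact ⟨V * U, mul_mem hV hU, by rw [mul_assoc, hUP, ← mul_assoc, hVR, mul_assoc]⟩

/-! ### Recovering a Pauli from its phase operator -/

theorem one_sub_omega_sq_ne_zero (hω : IsPrimitiveRoot ω 8) : (1 - ω ^ 2) / 2 ≠ 0 := by
  intro h
  have hi := omega_sq_mul_omega_sq hω
  have h1 : ω ^ 2 = 1 := by linear_combination -2 * h
  rw [h1] at hi; norm_num at hi

theorem one_add_omega_sq_ne_zero (hω : IsPrimitiveRoot ω 8) : (1 + ω ^ 2) / 2 ≠ 0 := by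
  intro h
  have hi := omega_sq_mul_omega_sq hω
  have h1 : ω ^ 2 = -1 := by linear_combination 2 * h
  rw [h1] at hi; norm_num at hi

/-- A phase operator along a non-scalar Pauli operator determines that Pauli operator, even up to
a global phase. -/
theorem phaseOperator_injective (hω : IsPrimitiveRoot ω 8) {P Q : UnitaryGroup n}
    (hP : P ∈ properPauli hω n) (hQ : Q ∈ properPauli hω n) {c : unitary ℂ}
    (h : phaseOperator hω P hP.1.2 = scalarGate n c * phaseOperator hω Q hQ.1.2) : P = Q := by
  obtain ⟨R, hR, h1, h2⟩ := exists_anticommute_both hω hP hQ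
  have conj : ∀ {A : UnitaryGroup n} (hA : A * A = 1), A * R = -(R * A) →
      R * phaseOperator hω A hA * R⁻¹ = phaseOperator hω (-A) (by rw [neg_mul_neg, hA]) :=
    fun hA hAR => mul_mul_inv_eq (mul_phaseOperator hω hA _ (by rw [neg_mul, hAR, neg_neg]))
  -- Conjugation by R flips the signs of P and Q simultaneously and leaves the phase c alone.
  have h3 : phaseOperator hω (-P) (by rw [neg_mul_neg, hP.1.2]) =
      scalarGate n c * phaseOperator hω (-Q) (by rw [neg_mul_neg, hQ.1.2]) := by
    rw [← conj hP.1.2 h1, ← conj hQ.1.2 h2, h, ← mul_assoc, scalarGate_comm, mul_assoc, mul_assoc,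
      mul_assoc]
  have e1 : ((1 + ω ^ 2) / 2) • (1 : Matrix (Fin n → Fin 2) (Fin n → Fin 2) ℂ) +
      ((1 - ω ^ 2) / 2) • P.1 =
        ((c : ℂ) • 1) * (((1 + ω ^ 2) / 2) • 1 + ((1 - ω ^ 2) / 2) • Q.1) :=
    congrArg Subtype.val h
  have e2 : ((1 + ω ^ 2) / 2) • (1 : Matrix (Fin n → Fin 2) (Fin n → Fin 2) ℂ) +
      ((1 - ω ^ 2) / 2) • (-P.1) =
        ((c : ℂ) • 1) * (((1 + ω ^ 2) / 2) • 1 + ((1 - ω ^ 2) / 2) • (-Q.1)) :=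
    congrArg Subtype.val h3
  rw [smul_mul_assoc, one_mul] at e1 e2
  -- Adding the two equations eliminates P and Q and leaves 1 + i = c (1 + i); one diagonal entry
  -- suffices to read this off.
  have hc : (c : ℂ) = 1 := by
    have f1 := congrFun (congrFun e1 0) 0
    have f2 := congrFun (congrFun e2 0) 0
    simp only [Matrix.add_apply, Matrix.smul_apply, Matrix.neg_apply, Matrix.one_apply_eq,
      smul_eq_mul, mul_one] at f1 f2
    refine mul_right_cancel₀ (one_add_omega_sq_ne_zero hω) ?_
    linear_combination (-1 / 2) * f1 + (-1 / 2) * f2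
  rw [hc, one_smul] at e1
  exact Subtype.ext (smul_right_injective _ (one_sub_omega_sq_ne_zero hω) (add_left_cancel e1))

theorem onQubit_gateS (hω : IsPrimitiveRoot ω 8) (j : Fin n)
    (h : onQubit j gateZ * onQubit j gateZ = 1) :
    onQubit j (gateS hω) = phaseOperator hω (onQubit j gateZ) h :=
  Subtype.ext (by
    rw [coe_phaseOperator]
    have h1 : (onQubit j (1 : Gate)).1 = (1 : Matrix (Fin n → Fin 2) (Fin n → Fin 2) ℂ) :=
      congrArg Subtype.val (map_one (onQubit j))
    rw [← h1]
    ext x y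
    simp only [Matrix.add_apply, Matrix.smul_apply, onQubit_apply]
    split_ifs
    · generalize x j = a
      generalize y j = b
      fin_cases a <;> fin_cases b <;> simp [gateS, gateZ] <;> ring
    · simp)

/-! ### Counting Hermitian Paulis -/

/-- The one-qubit Hermitian Pauli gates: `pauliGate (x, z)` is `X^x Z^z` times a phase. -/
noncomputable def pauliGate (hω : IsPrimitiveRoot ω 8) : Bool × Bool → Gate
  | (false, false) => 1
  | (true, false) => gateX
  | (false, true) => gateZ
  | (true, true) => ⟨(ω ^ 2) • (gateX * gateZ : Gate).1, by
      rw [Matrix.mem_unitaryGroup_iff, star_smul, smul_mul_smul_comm, star_omega_sq hω, mul_neg,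
        omega_sq_mul_omega_sq hω, neg_neg, one_smul]
      exact Matrix.mem_unitaryGroup_iff.mp (gateX * gateZ : Gate).2⟩

theorem gateX_mul_gateZ_mul_self : gateX * gateZ * (gateX * gateZ) = -1 := by
  have h : gateZ * gateX = -(gateX * gateZ) := by rw [gateX_mul_gateZ, neg_neg]
  rw [mul_assoc, ← mul_assoc gateZ, h, neg_mul, mul_assoc, gateZ_mul_self, mul_one, mul_neg,
    gateX_mul_self]

theorem pauliGate_mul_self (hω : IsPrimitiveRoot ω 8) (p : Bool × Bool) :
    pauliGate hω p * pauliGate hω p = 1 := by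
  rcases p with ⟨_ | _, _ | _⟩
  · exact mul_one 1
  · exact gateZ_mul_self
  · exact gateX_mul_self
  · refine Subtype.ext ?_
    have h : (gateX * gateZ : Gate).1 * (gateX * gateZ : Gate).1 = -1 :=
      congrArg Subtype.val gateX_mul_gateZ_mul_self
    change (ω ^ 2) • (gateX * gateZ : Gate).1 * (ω ^ 2) • (gateX * gateZ : Gate).1 = 1
    rw [smul_mul_smul_comm, omega_sq_mul_omega_sq hω, h, neg_smul, one_smul, neg_neg]

theorem pauliGate_mul_gateX (hω : IsPrimitiveRoot ω 8) (p : Bool × Bool) :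
    pauliGate hω p * gateX = (bif p.2 then -1 else 1) * gateX * pauliGate hω p := by
  rcases p with ⟨_ | _, _ | _⟩ <;> refine Subtype.ext ?_
  · change (1 * gateX : Gate).1 = (1 * gateX * 1 : Gate).1
    simp
  · change (gateZ * gateX : Gate).1 = (-1 * gateX * gateZ : Gate).1
    rw [mul_assoc, gateX_mul_gateZ, neg_one_mul, neg_neg]
  · change (gateX * gateX : Gate).1 = (1 * gateX * gateX : Gate).1
    rw [one_mul]
  · change ((ω ^ 2) • (gateX * gateZ : Gate).1) * gateX.1 =
      (-1 * gateX : Gate).1 * ((ω ^ 2) • (gateX * gateZ : Gate).1)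
    have h : gateX * gateZ * gateX = -1 * gateX * (gateX * gateZ) := by
      rw [neg_one_mul, gateX_mul_gateZ, neg_mul_neg, ← mul_assoc, gateX_mul_gateZ, neg_mul]
    rw [smul_mul_assoc, mul_smul_comm]
    exact congrArg (fun A : Gate => (ω ^ 2) • A.1) h

theorem pauliGate_mul_gateZ (hω : IsPrimitiveRoot ω 8) (p : Bool × Bool) :
    pauliGate hω p * gateZ = (bif p.1 then -1 else 1) * gateZ * pauliGate hω p := by
  rcases p with ⟨_ | _, _ | _⟩ <;> refine Subtype.ext ?_
  · change (1 * gateZ : Gate).1 = (1 * gateZ * 1 : Gate).1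
    simp
  · change (gateZ * gateZ : Gate).1 = (1 * gateZ * gateZ : Gate).1
    rw [one_mul]
  · change (gateX * gateZ : Gate).1 = (-1 * gateZ * gateX : Gate).1
    rw [mul_assoc, gateX_mul_gateZ, neg_one_mul]
  · change ((ω ^ 2) • (gateX * gateZ : Gate).1) * gateZ.1 =
      (-1 * gateZ : Gate).1 * ((ω ^ 2) • (gateX * gateZ : Gate).1)
    have h : gateX * gateZ * gateZ = -1 * gateZ * (gateX * gateZ) := by
      rw [neg_one_mul, neg_mul, ← mul_assoc, ← neg_mul, ← gateX_mul_gateZ]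
    rw [smul_mul_assoc, mul_smul_comm]
    exact congrArg (fun A : Gate => (ω ^ 2) • A.1) h

theorem onQubit_pauliGate_mem (hω : IsPrimitiveRoot ω 8) (j : Fin n) (p : Bool × Bool) :
    onQubit j (pauliGate hω p) ∈ pauliGroup hω n := by
  rcases p with ⟨_ | _, _ | _⟩
  · change onQubit j 1 ∈ _
    rw [map_one]; exact one_mem _
  · exact onQubit_Z_mem hω j
  · exact onQubit_X_mem hω j
  · rw [onQubit_mul_scalar j (gateX * gateZ) (root hω ^ 2) (pauliGate hω (true, true)) rfl, map_mul]
    exact mul_mem (imaginaryUnit_mem hω) (mul_mem (onQubit_X_mem hω j) (onQubit_Z_mem hω j))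

theorem tensorGate_pauliGate_mem (hω : IsPrimitiveRoot ω 8) (a : Fin n → Bool × Bool) :
    tensorGate n (fun j => pauliGate hω (a j)) ∈ hermitianPauli hω n := by
  constructor
  · have h : (fun j => pauliGate hω (a j)) ∈ (pauliGroup hω n).comap (tensorGate n) :=
      Subgroup.pi_mem_of_mulSingle_mem _ fun j => onQubit_pauliGate_mem hω j (a j)
    exact h
  · rw [← map_mul, ← map_one (tensorGate n)]
    exact congrArg _ (funext fun j => pauliGate_mul_self hω (a j))

theorem tensorGate_mul_onQubit (A : Fin n → Gate) (j : Fin n) (B : Gate) (s : Bool)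
    (h : A j * B = (bif s then -1 else 1) * B * A j) :
    tensorGate n A * onQubit j B = (bif s then -1 else 1) * (onQubit j B * tensorGate n A) := by
  have e : A * Pi.mulSingle j B =
      (Pi.mulSingle j (bif s then -1 else 1) * Pi.mulSingle j B) * A := by
    funext k
    by_cases hk : k = j
    · subst hk; simpa using h
    · simp [hk]
  have e' := congrArg (tensorGate n) e
  rw [map_mul, map_mul, map_mul] at e'
  have e'' : onQubit j (bif s then -1 else 1) = (bif s then -1 else 1 : UnitaryGroup n) := by
    cases s
    · exact map_one _
    · exact (onQubit_neg j 1).trans (congrArg _ (map_one _))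
  rw [← e'', ← mul_assoc]
  exact e'

theorem sign_mul_injective {s t : Bool} {U : UnitaryGroup n}
    (h : (bif s then -1 else 1) * U = (bif t then -1 else 1) * U) : s = t := by
  cases s <;> cases t <;> simp at h ⊢
  · exact ne_neg_self _ h
  · exact ne_neg_self _ h.symm

/-- The Hermitian Pauli operator with given sign and given tensor factors. -/
noncomputable def signedPauli (hω : IsPrimitiveRoot ω 8) (n : ℕ)
    (p : Bool × (Fin n → Bool × Bool)) : hermitianPauli hω n :=
  ⟨(bif p.1 then -1 else 1) * tensorGate n (fun j => pauliGate hω (p.2 j)), by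
    have h := tensorGate_pauliGate_mem hω p.2
    rcases p with ⟨_ | _, a⟩
    · simpa using h
    · simpa [hermitianPauli] using And.intro (neg_mem_pauliGroup hω h.1) h.2⟩

theorem sign_comm (s : Bool) (U : UnitaryGroup n) :
    U * (bif s then -1 else 1) = (bif s then -1 else 1) * U := by
  cases s <;> simp

theorem signedPauli_mul_gateX (hω : IsPrimitiveRoot ω 8) (p : Bool × (Fin n → Bool × Bool))
    (j : Fin n) : (signedPauli hω n p).1 * onQubit j gateX =
      (bif (p.2 j).2 then -1 else 1) * (onQubit j gateX * (signedPauli hω n p).1) := by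
  change (bif p.1 then -1 else 1) * tensorGate n _ * onQubit j gateX = _ *
    (onQubit j gateX * ((bif p.1 then -1 else 1) * tensorGate n _))
  rw [mul_assoc, tensorGate_mul_onQubit _ _ _ _ (pauliGate_mul_gateX hω (p.2 j)),
    ← mul_assoc (onQubit j gateX), sign_comm, mul_assoc, ← mul_assoc, sign_comm, mul_assoc]

theorem signedPauli_mul_gateZ (hω : IsPrimitiveRoot ω 8) (p : Bool × (Fin n → Bool × Bool))
    (j : Fin n) : (signedPauli hω n p).1 * onQubit j gateZ =
      (bif (p.2 j).1 then -1 else 1) * (onQubit j gateZ * (signedPauli hω n p).1) := by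
  change (bif p.1 then -1 else 1) * tensorGate n _ * onQubit j gateZ = _ *
    (onQubit j gateZ * ((bif p.1 then -1 else 1) * tensorGate n _))
  rw [mul_assoc, tensorGate_mul_onQubit _ _ _ _ (pauliGate_mul_gateZ hω (p.2 j)),
    ← mul_assoc (onQubit j gateZ), sign_comm, mul_assoc, ← mul_assoc, sign_comm, mul_assoc]

theorem exists_sign (hω : IsPrimitiveRoot ω 8) {P Q : UnitaryGroup n}
    (hP : P ∈ pauliGroup hω n) (hQ : Q ∈ pauliGroup hω n) :
    ∃ s : Bool, P * Q = (bif s then -1 else 1) * (Q * P) := by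
  rcases commute_or_anticommute hω hP hQ with h | h
  · exact ⟨false, by simpa using h⟩
  · exact ⟨true, by simpa using h⟩

theorem mul_commute_of_same_sign {A B C : UnitaryGroup n} {s : Bool}
    (hA : A * C = (bif s then -1 else 1) * (C * A))
    (hB : B * C = (bif s then -1 else 1) * (C * B)) :
    A * B * C = C * (A * B) := by
  rw [mul_assoc, hB]
  cases s
  · simp at hA ⊢
    rw [← mul_assoc, hA, mul_assoc]
  · simp at hA ⊢
    rw [← mul_assoc, hA, neg_mul, neg_neg, mul_assoc]

/-- The commutation signs with the X_j and Z_j determine the tensor factors. Two Hermitian Paulis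
with equal signs have a product that commutes with every X_j and Z_j, so they differ by a scalar,
which must be ±1. -/
theorem signedPauli_bijective (hω : IsPrimitiveRoot ω 8) (n : ℕ) :
    Function.Bijective (signedPauli hω n) := by
  constructor
  · rintro ⟨s, a⟩ ⟨t, b⟩ h
    have hab : a = b := by
      funext j
      have hX := signedPauli_mul_gateX hω (s, a) j
      have hZ := signedPauli_mul_gateZ hω (s, a) j
      rw [h, signedPauli_mul_gateX] at hX
      rw [h, signedPauli_mul_gateZ] at hZ
      exact Prod.ext (sign_mul_injective hZ).symm (sign_mul_injective hX).symm
    subst hab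
    exact Prod.ext (sign_mul_injective (congrArg Subtype.val h)) rfl
  · rintro ⟨P, hP⟩
    -- The roles cross: the sign against X_j gives the exponent of Z at j, and the sign against Z_j
    -- that of X.
    choose z hz using fun j => exists_sign hω hP.1 (onQubit_X_mem hω j)
    choose x hx using fun j => exists_sign hω hP.1 (onQubit_Z_mem hω j)
    set T := signedPauli hω n (false, fun j => (x j, z j))
    have hTX := signedPauli_mul_gateX hω (false, fun j => (x j, z j))
    have hTZ := signedPauli_mul_gateZ hω (false, fun j => (x j, z j))
    obtain ⟨c, hc⟩ := eq_scalarGate_of_commute (U := P * T.1)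
      (fun j => mul_commute_of_same_sign (hz j) (hTX j))
      (fun j => mul_commute_of_same_sign (hx j) (hTZ j))
    have hPT : P = scalarGate n c * T.1 := by rw [← hc, mul_assoc, T.2.2, mul_one]
    have hcc : scalarGate n c * scalarGate n c = 1 := by
      have h := hP.2
      rwa [hPT, mul_assoc, ← mul_assoc T.1, scalarGate_comm, mul_assoc, T.2.2, mul_one] at h
    have hT1 : T.1 = tensorGate n (fun j => pauliGate hω (x j, z j)) := one_mul _
    rcases eq_one_or_eq_neg_one_of_scalar hcc with h | h
    · exact ⟨(false, fun j => (x j, z j)), Subtype.ext (by simpa [h] using hPT.symm)⟩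
    · exact ⟨(true, fun j => (x j, z j)), Subtype.ext ((hPT.trans (by rw [h, hT1]; rfl)).symm)⟩

theorem ncard_hermitianPauli (hω : IsPrimitiveRoot ω 8) (n : ℕ) :
    (hermitianPauli hω n).ncard = 2 * 4 ^ n := by
  rw [← Nat.card_coe_set_eq, ← Nat.card_eq_of_bijective _ (signedPauli_bijective hω n)]
  simp

theorem ncard_properPauli (hω : IsPrimitiveRoot ω 8) (n : ℕ) :
    (properPauli hω n).ncard = 2 * (4 ^ n - 1) := by
  have hsub : ({1, -1} : Set (UnitaryGroup n)) ⊆ hermitianPauli hω n := by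
    rintro _ (rfl | rfl)
    · exact ⟨one_mem _, mul_one 1⟩
    · exact ⟨neg_mem_pauliGroup hω (one_mem _), by simp⟩
  rw [properPauli, Set.ncard_sdiff hsub, ncard_hermitianPauli, Set.ncard_pair (ne_neg_self 1)]
  omega

/-! ### The conjugacy class of the phase gate and the action on it -/

/-- The class in `C_n` of the phase operator along a non-scalar Hermitian Pauli operator. -/
noncomputable def phaseOf (hω : IsPrimitiveRoot ω 8) (P : properPauli hω n) :
    ProjectiveCliffordGroup hω n :=
  QuotientGroup.mk ⟨phaseOperator hω P.1 P.2.1.2, phaseOperator_mem_cliffordGroup hω _ P.2.1.1⟩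

theorem phaseOf_injective (hω : IsPrimitiveRoot ω 8) :
    Function.Injective (phaseOf hω (n := n)) := by
  intro P Q h
  obtain ⟨c, hc⟩ := Subgroup.mem_subgroupOf.mp (QuotientGroup.eq.mp h.symm)
  refine Subtype.ext (phaseOperator_injective hω P.2 Q.2 (c := c) ?_)
  rw [← scalarGate_comm, hc]
  simp

/-- The action of a Clifford operator on non-scalar Hermitian Pauli operators. -/
def conjPauli (hω : IsPrimitiveRoot ω 8) (U : cliffordGroup hω n) (P : properPauli hω n) :
    properPauli hω n :=
  ⟨U * P * (U : UnitaryGroup n)⁻¹, conj_mem_properPauli hω U.2 P.2⟩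

theorem conj_phaseOf (hω : IsPrimitiveRoot ω 8) (U : cliffordGroup hω n) (P : properPauli hω n) :
    (U : ProjectiveCliffordGroup hω n) * phaseOf hω P * (U : ProjectiveCliffordGroup hω n)⁻¹ =
      phaseOf hω (conjPauli hω U P) := by
  refine congrArg (QuotientGroup.mk : cliffordGroup hω n → ProjectiveCliffordGroup hω n)
    (Subtype.ext ?_)
  exact mul_mul_inv_eq (mul_phaseOperator hω P.2.1.2 (conjPauli hω U P).2.1.2
    (inv_mul_cancel_right _ _).symm)

theorem phase_eq_phaseOf (hω : IsPrimitiveRoot ω 8) (j : Fin n) :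
    phase hω j = phaseOf hω ⟨onQubit j gateZ, onQubit_Z_mem_properPauli hω j⟩ :=
  congrArg (QuotientGroup.mk : cliffordGroup hω n → ProjectiveCliffordGroup hω n)
    (Subtype.ext (onQubit_gateS hω j (onQubit_Z_mem_properPauli hω j).1.2))

theorem phaseClass_eq_range (hω : IsPrimitiveRoot ω 8) (j : Fin n) :
    phaseClass hω j = Set.range (phaseOf hω (n := n)) := by
  ext v
  rw [phaseClass, conjugatesOf, Set.mem_ofPred_eq, isConj_iff, phase_eq_phaseOf]
  constructor
  · rintro ⟨g, rfl⟩
    induction g using QuotientGroup.induction_on with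
    | H U => exact ⟨_, (conj_phaseOf hω U _).symm⟩
  · rintro ⟨P, rfl⟩
    obtain ⟨U, hU, h⟩ := exists_conj_eq hω (onQubit_Z_mem_properPauli hω j) P.2
    refine ⟨((⟨U, hU⟩ : cliffordGroup hω n) : ProjectiveCliffordGroup hω n), ?_⟩
    rw [conj_phaseOf]
    exact congrArg _ (Subtype.ext (mul_mul_inv_eq h))

theorem card_phaseClass (hω : IsPrimitiveRoot ω 8) (j : Fin n) :
    Nat.card (phaseClass hω j) = 2 * (4 ^ n - 1) := by
  rw [phaseClass_eq_range, ← Nat.card_congr (Equiv.ofInjective _ (phaseOf_injective hω)),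
    Nat.card_coe_set_eq, ncard_properPauli]

/-- Fixing the class of S_P forces UPU⁻¹ = P exactly, since that class determines P with its sign.
Taking P = X_j and P = Z_j makes U scalar. -/
theorem eq_one_of_conj_phaseOf (hω : IsPrimitiveRoot ω 8) {g : ProjectiveCliffordGroup hω n}
    (h : ∀ P : properPauli hω n, g * phaseOf hω P * g⁻¹ = phaseOf hω P) : g = 1 := by
  induction g using QuotientGroup.induction_on with
  | H U =>
    have hU : ∀ P ∈ properPauli hω n, (U : UnitaryGroup n) * P = P * U := by
      intro P hP
      have h1 := h ⟨P, hP⟩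
      rw [conj_phaseOf] at h1
      exact mul_inv_eq_iff_eq_mul.mp (congrArg Subtype.val (phaseOf_injective hω h1))
    obtain ⟨c, hc⟩ := eq_scalarGate_of_commute
      (fun j => hU _ (onQubit_X_mem_properPauli hω j))
      fun j => hU _ (onQubit_Z_mem_properPauli hω j)
    exact (QuotientGroup.eq_one_iff U).mpr ⟨c, hc.symm⟩

/-- The conjugation action of a group on a conjugacy class. -/
def conjugatesPerm {G : Type*} [Group G] (a : G) : G →* Equiv.Perm (conjugatesOf a) where
  toFun g :=
    { toFun := fun v => ⟨g * v * g⁻¹, IsConj.trans v.2 (isConj_iff.mpr ⟨g, rfl⟩)⟩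
      invFun := fun v => ⟨g⁻¹ * v * g, IsConj.trans v.2 (isConj_iff.mpr ⟨g⁻¹, by rw [inv_inv]⟩)⟩
      left_inv := fun v => Subtype.ext (by simp [mul_assoc])
      right_inv := fun v => Subtype.ext (by simp [mul_assoc]) }
  map_one' := by ext v; simp
  map_mul' g h := by ext v; simp [mul_assoc]

theorem conjugatesPerm_phase_injective (hω : IsPrimitiveRoot ω 8) (j : Fin n) :
    Function.Injective (conjugatesPerm (phase hω j)) := by
  refine (injective_iff_map_eq_one _).mpr fun g hg => eq_one_of_conj_phaseOf hω fun P => ?_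
  have hP : phaseOf hω P ∈ conjugatesOf (phase hω j) := by
    change _ ∈ phaseClass hω j
    rw [phaseClass_eq_range]
    exact ⟨P, rfl⟩
  exact congrArg Subtype.val (Equiv.congr_fun hg ⟨_, hP⟩)

end QubitClifford

theorem mainTheorem1 {ω : ℂ} (hω : IsPrimitiveRoot ω 8) (n : ℕ) (hn : 0 < n) :
    (∃ σ : QubitClifford.ProjectiveCliffordGroup hω n →*
          Equiv.Perm (QubitClifford.phaseClass hω (⟨0, hn⟩ : Fin n)),
        (∀ (g : QubitClifford.ProjectiveCliffordGroup hω n)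
            (v : QubitClifford.phaseClass hω (⟨0, hn⟩ : Fin n)),
          (σ g v : QubitClifford.ProjectiveCliffordGroup hω n) = g * v * g⁻¹) ∧
        Function.Injective σ) ∧
      Nat.card (QubitClifford.phaseClass hω (⟨0, hn⟩ : Fin n)) = 2 * (4 ^ n - 1) ∧
      ∃ φ : QubitClifford.ProjectiveCliffordGroup hω n →*
          Equiv.Perm (Fin (2 * (4 ^ n - 1))),
        Function.Injective φ := by
  have hinj := QubitClifford.conjugatesPerm_phase_injective hω (⟨0, hn⟩ : Fin n)
  have hcard := QubitClifford.card_phaseClass hω (⟨0, hn⟩ : Fin n)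
  -- `Nat.card` is 0 on infinite types, so the count yields finiteness only once it is known to be
  -- nonzero; this is where n ≥ 1 enters.
  have hpos : 2 * (4 ^ n - 1) ≠ 0 := by
    have := Nat.one_lt_pow hn.ne' (show 1 < 4 by norm_num)
    omega
  have : Finite (QubitClifford.phaseClass hω (⟨0, hn⟩ : Fin n)) :=
    Nat.finite_of_card_ne_zero (hcard ▸ hpos)
  let e := (Finite.equivFinOfCardEq hcard).permCongrHom
  exact ⟨⟨_, fun _ _ => rfl, hinj⟩, hcard,
    e.toMonoidHom.comp (QubitClifford.conjugatesPerm _), e.injective.comp hinj⟩
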